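/- **Setting.** Let $d,k,j\ge 1$ be integers with $j$ even, let $c,\sigma>0$, and let $\{G_i\}_{i\ge1}$ be finite connected non-bipartite simple graphs; $G_i$ has $N_i$ vertices, all of degree in $[3,d]$, the numbers $N_i$ are unbounded, the girth of $G_i$ is at least $c\log N_i$, and the spectral gap of the standard random walk on $G_i$ is at least $\sigma$. Let $G=\bigsqcup_i G_i$, let $\Gamma$ be the free group on $k$ generators, and let $S$ be the set of the $2k$ generators and inverses. Orient the edges of $G$ arbitrarily and assign to every edge independently a uniformly random word of length $j$ in the letters $S$; the label $\alpha(\vec e)\in\Gamma$ of an oriented edge is the value of this word, or the inverse of the value, according to the orientation. Let $\Gamma_\alpha$ be the quotient of $\Gamma$ by the normal closure of the products $\alpha(\vec e_1)\cdots\alpha(\vec e_r)$ along all closed paths of $G$. Let $\mu_X$ be the standard random walk on the Cayley graph $X$ of $(\Gamma,S)$, and $\mu_X^n$ its $n$-th convolution power. When $\Gamma_\alpha$ acts by isometries on a metric space $Y$ and $f:\Gamma_\alpha\to Y$ is equivariant for left multiplication, also write $f$ for its pull-back to $X$, and let $$E^{(p)}_{\mu_X^n}(f)=\tfrac12\sum_{x'}\mu_X^n(x\to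 x')\,d_Y(f(x),f(x'))^p ,$$ which does not depend on $x$. For $\sigma>0$, $p\ge2$, let $\Lambda^{(p)}_Y(\sigma)\in[0,\infty]$ be the smallest $\Lambda$ such that for every finite ergodic Markov chain $(V,\mu,\nu)$ reversible with respect to the probability measure $\nu$ and with spectral gap ($1$ minus the second largest eigenvalue) at least $\sigma$, and every $h:V\to Y$, $$\sum_{u,v}\nu(u)\nu(v)\,d_Y(h(u),h(v))^p\le\Lambda^p\sum_{u,v}\nu(u)\mu(u\to v)\,d_Y(h(u),h(v))^p ,$$ and let $\Lambda^{(p)}_Y(\sigma,N)=\sup\{\Lambda^{(p)}_{Y'}(\sigma): Y'\subseteq Y,\ |Y'|\le N\}$. **Theorem.** There are constants $K_p$, depending only on $p$, and $a,b>0$, depending only on $d,k,j,c$, such that in the above setting the following holds almost surely: for every metric space $Y$, every action of $\Gamma_\alpha$ on $Y$ by isometries, and every $p\ge2$, there are arbitrarily large $N_i$ such that for every equivariant $f:\Gamma_\alpha\to Y$ there is an integer $m$ with $a\log N_i\le m\le b\log N_i$ and $$E^{(p)}_{\mu_X^{jm}}(f)\le K_p\,\Lambda^{(p)}_Y(\sigma,N_i)^p\;E^{(p)}_{\mu_X^{j}}(f).$$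 -/

import Mathlib

open MeasureTheory
open scoped ENNReal NNReal

noncomputable section

namespace RandomGroup

/-! ### Random walks, energies, Poincaré moduli -/

/-- The `n`-fold convolution power of a random walk `μ` (`μ x` is the law of one step from `x`). -/
def walkPow {X : Type*} (μ : X → PMF X) : ℕ → X → PMF X
  | 0, x => PMF.pure x
  | n + 1, x => (walkPow μ n x).bind μ

/-- The walk `μ` is reversible with respect to the probability measure `ν`. -/
def IsReversible {X : Type*} (μ : X → PMF X) (ν : PMF X) : Prop :=
  ∀ x y, ν x * μ x y = ν y * μ y x

/-- Any state can be reached from any other state. -/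
def IsErgodic {X : Type*} (μ : X → PMF X) : Prop :=
  ∀ x y, ∃ n, 0 < walkPow μ n x y

/-- The averaging operator `(A φ)(u) = ∑ v, μ(u → v) φ(v)` of a finite Markov chain. -/
def averaging {V : Type*} [Fintype V] (μ : V → PMF V) : (V → ℝ) →ₗ[ℝ] (V → ℝ) where
  toFun φ u := ∑ v, (μ u v).toReal * φ v
  map_add' φ ψ := by
    funext u
    simp [mul_add, Finset.sum_add_distrib]
  map_smul' c φ := by
    funext u
    simp only [Pi.smul_apply, smul_eq_mul, RingHom.id_apply, Finset.mul_sum]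
    exact Finset.sum_congr rfl fun v _ => by ring

/-- The spectral gap of a finite ergodic reversible Markov chain: the difference between `1` and
the second largest eigenvalue of the averaging operator. For such a chain all eigenvalues are at
most `1` and the eigenvalue `1` is simple, so the second largest eigenvalue is the largest one
different from `1`. (For a one-point chain there is none, and the value is `⊤`.) -/
def spectralGap {V : Type*} [Fintype V] (μ : V → PMF V) : EReal :=
  ⨅ (t : ℝ) (_ : Module.End.HasEigenvalue (averaging μ) t ∧ t ≠ 1), ((1 - t : ℝ) : EReal)

/-- The Poincaré modulus of exponent `p` of the metric space `Y`: the smallest `L ∈ [0, ∞]` such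
that the Poincaré inequality with constant `L ^ p` holds for all `Y`-valued functions on finite
reversible ergodic Markov chains with spectral gap at least `σ`. -/
def poincareModulus (p σ : ℝ) (Y : Type*) [MetricSpace Y] : ℝ≥0∞ :=
  sInf {L : ℝ≥0∞ | ∀ (V : Type) [Fintype V] (μ : V → PMF V) (ν : PMF V),
    IsReversible μ ν → IsErgodic μ → (σ : EReal) ≤ spectralGap μ → ∀ f : V → Y,
      ∑ u, ∑ v, ν u * ν v * edist (f u) (f v) ^ p
        ≤ L ^ p * ∑ u, ∑ v, ν u * μ u v * edist (f u) (f v) ^ p}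

/-- The local Poincaré modulus: the supremum of the moduli of the subsets of `Y` with at most `N`
points. -/
def localPoincareModulus (p σ : ℝ) (Y : Type*) [MetricSpace Y] (N : ℕ) : ℝ≥0∞ :=
  ⨆ (Y' : Set Y) (_ : Y'.encard ≤ N), poincareModulus p σ Y'

/-- The `p`-th power of the gradient of `f` at `x` with respect to the walk `μ`. -/
def gradPow {X Y : Type*} [MetricSpace Y] (p : ℝ) (μ : X → PMF X) (f : X → Y) (x : X) : ℝ≥0∞ :=
  ∑' x', μ x x' * edist (f x) (f x') ^ p

/-- The energy of exponent `p` of an equivariant function on the group `Γ`, acting on itself from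
the left, with respect to an equivariant random walk `μ`. The quotient `Γ \ Γ` is one point, so
the integral of the (invariant) function `gradPow p μ f` over it is the value at `1`. -/
def energy {Γ Y : Type*} [Group Γ] [MetricSpace Y] (p : ℝ) (μ : Γ → PMF Γ) (f : Γ → Y) : ℝ≥0∞ :=
  2⁻¹ * gradPow p μ f 1

/-! ### The standard random walks on the tree and on finite graphs -/

/-- The standard random walk on the Cayley graph of the free group on `k` generators
with respect to the generators and their inverses (a `2k`-regular tree). -/
def treeWalk (k : ℕ) [NeZero k] (x : FreeGroup (Fin k)) : PMF (FreeGroup (Fin k)) :=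
  (PMF.uniformOfFintype (Fin k × Bool)).map fun s => x * FreeGroup.mk [s]

open Classical in
/-- The standard random walk on a finite graph (standing still at isolated vertices). -/
def graphWalk {V : Type*} [Fintype V] (G : SimpleGraph V) [DecidableRel G.Adj] (u : V) : PMF V :=
  if h : (G.neighborFinset u).Nonempty then PMF.uniformOfFinset (G.neighborFinset u) h
  else PMF.pure u

/-! ### The random group of a graph -/

/-- The disjoint union of a family of graphs. -/
def disjointUnion {ι : Type*} {V : ι → Type*} (G : ∀ i, SimpleGraph (V i)) :
    SimpleGraph (Σ i, V i) :=
  ⨆ i, (G i).map (Function.Embedding.sigmaMk i)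

/-- Words of length `j` in `2k` letters; `(a, true)` is the `a`-th generator and `(a, false)` is
its inverse. -/
abbrev Word (k j : ℕ) : Type := Fin j → Fin k × Bool

/-- The element of the free group represented by a word. -/
def Word.eval {k j : ℕ} (w : Word k j) : FreeGroup (Fin k) := FreeGroup.mk (List.ofFn w)

/-- An orientation of a graph: a section of the two-to-one map from oriented edges to edges. -/
structure Orientation {V : Type*} (G : SimpleGraph V) where
  dart : G.edgeSet → G.Dart
  edge_dart : ∀ e, (dart e).edge = e

open Classical in
/-- The symmetric labeling of the oriented edges of `G` given by one word per edge: the label is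
the word's value in the chosen direction, and its inverse in the other direction. -/
def label {V : Type*} {G : SimpleGraph V} {k j : ℕ} (o : Orientation G)
    (α : G.edgeSet → Word k j) (e : G.Dart) : FreeGroup (Fin k) :=
  if o.dart ⟨e.edge, e.edge_mem⟩ = e then (α ⟨e.edge, e.edge_mem⟩).eval
  else (α ⟨e.edge, e.edge_mem⟩).eval⁻¹

/-- The product of the labels along a path. -/
def pathLabel {V : Type*} {G : SimpleGraph V} {k j : ℕ} (o : Orientation G)
    (α : G.edgeSet → Word k j) {u v : V} (w : G.Walk u v) : FreeGroup (Fin k) :=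
  (w.darts.map (label o α)).prod

/-- The relators: labels of the closed paths of `G`. -/
def relators {V : Type*} {G : SimpleGraph V} {k j : ℕ} (o : Orientation G)
    (α : G.edgeSet → Word k j) : Set (FreeGroup (Fin k)) :=
  {r | ∃ (u : V) (w : G.Walk u u), pathLabel o α w = r}

/-- The quotient of the free group by the normal closure of the relators. -/
abbrev RGroup {V : Type*} {G : SimpleGraph V} {k j : ℕ} (o : Orientation G)
    (α : G.edgeSet → Word k j) : Type :=
  FreeGroup (Fin k) ⧸ Subgroup.normalClosure (relators o α)

/-- The law of the random labeling: the words on the edges of `G` are independent, and each of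
them is uniform among the `(2k) ^ j` words of length `j`. -/
def labelMeasure {V : Type*} (G : SimpleGraph V) (k j : ℕ) [NeZero k] :
    Measure (G.edgeSet → Word k j) :=
  Measure.infinitePi fun _ => (PMF.uniformOfFintype (Word k j)).toMeasure

instance {V : Type*} (G : SimpleGraph V) (k j : ℕ) [NeZero k] :
    IsProbabilityMeasure (labelMeasure G k j) := by
  unfold labelMeasure
  infer_instance

end RandomGroup

end

noncomputable section

namespace RandomGroup

/-! ### Laws of random walks on the free group -/

/-! A random walk on `G_i` is replaced by a deterministic flow: a permutation `T` of the oriented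
edges that continues each edge without backtracking. Below the girth, a trajectory meets `m`
distinct edges, so the words read along it are independent and uniform. Two trajectories are
correlated only if they share an edge, which leaves at most `2m²` partners for each. With `Q` words,
`D` oriented edges and `Q ^ m ≤ N_i ^ (1/8)`, Chebyshev and a union bound show that, outside an
event of probability `O(N_i ^ (-1/2))`, the labeling is balanced (`IsBalanced`): counts at length
`m` are at least half their mean `D / Q ^ m`, and at length `1` at most twice their mean.

For a balanced labeling the theorem is deterministic (`energy_le_of_isBalanced`). Since closed paths
die in `Γ_α`, `G_i` maps to `Γ_α` compatibly with labels. The energy at time `jm` is then at most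
twice the average `p`-th power displacement under `T ^ m`. As `T ^ m` preserves the uniform measure
on oriented edges, the triangle inequality through an independent point bounds this average by `2 ^
p` times the double average over `G_i`. The Poincaré inequality passes to the edge energy of `G_i`,
which is at most twice the average over words of length `j`. Hence `K_p = 2 ^ (p + 2)`. -/

theorem tsum_pure_mul {X : Type*} (x : X) (g : X → ℝ≥0∞) :
    ∑' y, PMF.pure x y * g y = g x := by
  rw [tsum_eq_single x fun y hy => by simp [PMF.pure_apply, hy]]
  simp

theorem tsum_bind_mul {X Z : Type*} (q : PMF X) (r : X → PMF Z) (g : Z → ℝ≥0∞) :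
    ∑' z, q.bind r z * g z = ∑' x, q x * ∑' z, r x z * g z := by
  simp only [PMF.bind_apply, ← ENNReal.tsum_mul_right, ← ENNReal.tsum_mul_left, mul_assoc]
  exact ENNReal.tsum_comm

theorem tsum_map_mul {X Z : Type*} (q : PMF X) (r : X → Z) (g : Z → ℝ≥0∞) :
    ∑' z, q.map r z * g z = ∑' x, q x * g (r x) := by
  rw [PMF.map, tsum_bind_mul]
  exact tsum_congr fun x => by rw [Function.comp_apply, tsum_pure_mul]

theorem walkPow_add {X : Type*} (μ : X → PMF X) (m n : ℕ) (x : X) :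
    walkPow μ (m + n) x = (walkPow μ m x).bind (walkPow μ n) := by
  induction n with
  | zero => exact (PMF.bind_pure _).symm
  | succ n ih =>
    change (walkPow μ (m + n) x).bind μ = (walkPow μ m x).bind fun y => (walkPow μ n y).bind μ
    rw [ih, PMF.bind_bind]

/-- Steps are grouped in blocks of `j` because a word of length `j` is the label of one edge. -/
theorem walkPow_mul {X : Type*} (μ : X → PMF X) (j m : ℕ) (x : X) :
    walkPow μ (j * m) x = walkPow (walkPow μ j) m x := by
  induction m generalizing x with
  | zero => rfl
  | succ m ih =>
    rw [Nat.mul_succ, walkPow_add, ih]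
    rfl

/-- If the law of one step from `x` is uniform over the elements `x * e s`, then the law of `n`
steps is uniform over the products of `n` increments. -/
theorem tsum_walkPow_mul {Γ S : Type*} [Group Γ] [Fintype S] (μ : Γ → PMF Γ) (e : S → Γ)
    (hμ : ∀ (x : Γ) (g : Γ → ℝ≥0∞),
      ∑' y, μ x y * g y = (Fintype.card S : ℝ≥0∞)⁻¹ * ∑ s, g (x * e s))
    (n : ℕ) (x : Γ) (g : Γ → ℝ≥0∞) :
    ∑' y, walkPow μ n x y * g y = ((Fintype.card S : ℝ≥0∞)⁻¹) ^ n *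
      ∑ w : Fin n → S, g (x * (List.ofFn fun i => e (w i)).prod) := by
  induction n generalizing g with
  | zero => simp [walkPow]
  | succ n ih =>
    rw [walkPow, tsum_bind_mul]
    simp only [hμ]
    rw [ih, pow_succ, ← Finset.mul_sum, ← mul_assoc]
    congr 1
    rw [← (Fin.snocEquiv fun _ : Fin (n + 1) => S).sum_comp, Fintype.sum_prod_type,
      Finset.sum_comm]
    refine Finset.sum_congr rfl fun w _ => Finset.sum_congr rfl fun s _ => ?_
    rw [List.ofFn_succ']
    simp [Fin.snocEquiv, mul_assoc]

theorem mk_ofFn_eq_prod {k n : ℕ} (w : Fin n → Fin k × Bool) :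
    FreeGroup.mk (List.ofFn w) = (List.ofFn fun i => FreeGroup.mk [w i]).prod := by
  have h : ∀ L : List (Fin k × Bool),
      FreeGroup.mk L = (L.map fun s => FreeGroup.mk [s]).prod := by
    intro L
    induction L with
    | nil => rfl
    | cons s L ih => rw [List.map_cons, List.prod_cons, ← ih, FreeGroup.mul_mk]; rfl
  rw [h, List.map_ofFn]
  rfl

theorem tsum_treeWalk_mul {k : ℕ} [NeZero k] (x : FreeGroup (Fin k))
    (g : FreeGroup (Fin k) → ℝ≥0∞) :
    ∑' y, treeWalk k x y * g y =
      (Fintype.card (Fin k × Bool) : ℝ≥0∞)⁻¹ * ∑ s, g (x * FreeGroup.mk [s]) := by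
  rw [treeWalk, tsum_map_mul, tsum_fintype, Finset.mul_sum]
  exact Finset.sum_congr rfl fun s _ => by rw [PMF.uniformOfFintype_apply]

theorem tsum_walkPow_treeWalk_mul {k : ℕ} [NeZero k] (j : ℕ) (x : FreeGroup (Fin k))
    (g : FreeGroup (Fin k) → ℝ≥0∞) :
    ∑' y, walkPow (treeWalk k) j x y * g y =
      (Fintype.card (Word k j) : ℝ≥0∞)⁻¹ * ∑ w : Word k j, g (x * w.eval) := by
  rw [tsum_walkPow_mul _ _ tsum_treeWalk_mul, ← ENNReal.inv_pow]
  simp only [← mk_ofFn_eq_prod, Word.eval]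
  congr 2
  simp

/-- The energy with respect to `j * m` steps of the standard walk is an average over `m`-tuples
of words of length `j`. -/
theorem energy_walkPow_treeWalk {k : ℕ} [NeZero k] {Y : Type*} [MetricSpace Y] (p : ℝ) (j m : ℕ)
    (F : FreeGroup (Fin k) → Y) :
    energy p (walkPow (treeWalk k) (j * m)) F = 2⁻¹ * (((Fintype.card (Word k j) : ℝ≥0∞)⁻¹) ^ m *
      ∑ ω : Fin m → Word k j, edist (F 1) (F (List.ofFn fun i => (ω i).eval).prod) ^ p) := by
  rw [energy, gradPow]
  simp only [walkPow_mul]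
  rw [tsum_walkPow_mul _ _ (tsum_walkPow_treeWalk_mul j) m 1
    fun y => edist (F 1) (F y) ^ p]
  simp only [one_mul]

/-! ### The Poincaré inequality of a finite graph -/

/-- The chain `μ` carried over by a bijection of the state spaces. -/
def transport {V W : Type*} (e : V ≃ W) (μ : V → PMF V) (x : W) : PMF W := (μ (e.symm x)).map e

theorem map_equiv_apply {V W : Type*} (e : V ≃ W) (q : PMF V) (y : W) :
    q.map e y = q (e.symm y) := by
  rw [PMF.map_apply, tsum_eq_single (e.symm y)]
  · simp
  · intro x hx
    rw [if_neg]
    rintro rfl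
    simp at hx

theorem transport_apply {V W : Type*} (e : V ≃ W) (μ : V → PMF V) (x y : W) :
    transport e μ x y = μ (e.symm x) (e.symm y) :=
  map_equiv_apply e _ y

theorem walkPow_transport {V W : Type*} (e : V ≃ W) (μ : V → PMF V) (n : ℕ) (x y : W) :
    walkPow (transport e μ) n x y = walkPow μ n (e.symm x) (e.symm y) := by
  classical
  induction n generalizing y with
  | zero => simp [walkPow, PMF.pure_apply]
  | succ n ih =>
    simp only [walkPow, PMF.bind_apply, ih, transport_apply]
    exact e.symm.tsum_eq fun a => walkPow μ n (e.symm x) a * μ a (e.symm y)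

/-- Eigenvectors pull back along the bijection. Only this direction is needed, to keep the lower
bound on the gap. -/
theorem spectralGap_le_transport {V W : Type*} [Fintype V] [Fintype W] (e : V ≃ W)
    (μ : V → PMF V) : spectralGap μ ≤ spectralGap (transport e μ) := by
  refine le_iInf₂ fun t ht => iInf₂_le_of_le t ⟨?_, ht.2⟩ le_rfl
  obtain ⟨φ, hφ⟩ := ht.1.exists_hasEigenvector
  refine Module.End.hasEigenvalue_of_hasEigenvector (x := φ ∘ e) ⟨?_, ?_⟩
  · rw [Module.End.mem_eigenspace_iff]
    funext u
    have h := congrFun (Module.End.mem_eigenspace_iff.mp hφ.1) (e u)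
    change ∑ v, (transport e μ (e u) v).toReal * φ v = t * φ (e u) at h
    change ∑ v, (μ u v).toReal * φ (e v) = t * φ (e u)
    rw [← h, ← e.sum_comp]
    simp [transport_apply]
  · intro h
    refine hφ.2 (funext fun w => ?_)
    simpa using congrFun h (e.symm w)

/-- The infimum defining the modulus is attained: divide by the energy, which is finite. Zero energy
cannot be divided by, whence `hdeg`. The modulus tests only chains in `Type`, so the chain is first
moved to `Fin n`. -/
theorem poincareModulus_spec {p σ : ℝ} (hp : 0 < p) {Y : Type*} [MetricSpace Y] {V : Type*}
    [Fintype V] (μ : V → PMF V) (ν : PMF V) (hrev : IsReversible μ ν) (herg : IsErgodic μ)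
    (hgap : (σ : EReal) ≤ spectralGap μ) (f : V → Y)
    (hdeg : ∑ u, ∑ v, ν u * μ u v * edist (f u) (f v) ^ p = 0 →
      ∑ u, ∑ v, ν u * ν v * edist (f u) (f v) ^ p = 0) :
    ∑ u, ∑ v, ν u * ν v * edist (f u) (f v) ^ p ≤
      poincareModulus p σ Y ^ p * ∑ u, ∑ v, ν u * μ u v * edist (f u) (f v) ^ p := by
  set A := ∑ u, ∑ v, ν u * ν v * edist (f u) (f v) ^ p with hA
  set B := ∑ u, ∑ v, ν u * μ u v * edist (f u) (f v) ^ p with hB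
  by_cases hB0 : B = 0
  · rw [hdeg hB0]; exact zero_le
  have hBt : B ≠ ⊤ := by
    refine (ENNReal.sum_lt_top.2 fun u _ => ENNReal.sum_lt_top.2 fun v _ => ?_).ne
    exact ENNReal.mul_lt_top
      (ENNReal.mul_lt_top (PMF.apply_lt_top _ _) (PMF.apply_lt_top _ _))
      (ENNReal.rpow_lt_top_of_nonneg hp.le (edist_ne_top _ _))
  rw [← ENNReal.div_le_iff hB0 hBt, ← ENNReal.rpow_inv_le_iff hp, poincareModulus]
  refine le_sInf fun L hL => ?_
  rw [ENNReal.rpow_inv_le_iff hp, ENNReal.div_le_iff hB0 hBt]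
  let e : V ≃ Fin (Fintype.card V) := Fintype.equivFin V
  have key := hL (Fin (Fintype.card V)) (transport e μ) (ν.map e) ?_ ?_
    (hgap.trans (spectralGap_le_transport e μ)) (f ∘ e.symm)
  · simp only [map_equiv_apply, transport_apply, Function.comp_apply] at key
    have hs : ∀ X : V → V → ℝ≥0∞, ∑ u, ∑ v, X (e.symm u) (e.symm v) = ∑ u, ∑ v, X u v := by
      intro X
      rw [e.symm.sum_comp fun u => ∑ v, X u (e.symm v)]
      exact Finset.sum_congr rfl fun u _ => e.symm.sum_comp (X u)
    rw [hs fun u v => ν u * ν v * edist (f u) (f v) ^ p,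
      hs fun u v => ν u * μ u v * edist (f u) (f v) ^ p] at key
    exact key
  · intro x y
    simp only [map_equiv_apply, transport_apply]
    exact hrev _ _
  · intro x y
    obtain ⟨n, hn⟩ := herg (e.symm x) (e.symm y)
    exact ⟨n, by rwa [walkPow_transport]⟩

section Graph

variable {V : Type*} [Fintype V] (G : SimpleGraph V) [DecidableRel G.Adj]

/-- The law of the origin of a uniformly random oriented edge. -/
def stationary [Nonempty G.Dart] : PMF V := by
  classical exact (PMF.uniformOfFintype G.Dart).map fun e => e.fst

theorem sum_stationary_mul [Nonempty G.Dart] (φ : V → ℝ≥0∞) :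
    ∑ u, stationary G u * φ u = (Fintype.card G.Dart : ℝ≥0∞)⁻¹ * ∑ e : G.Dart, φ e.fst := by
  classical
  rw [← tsum_fintype (L := .unconditional V), stationary, tsum_map_mul, tsum_fintype, Finset.mul_sum]
  refine Finset.sum_congr rfl fun e _ => ?_
  rw [PMF.uniformOfFintype_apply]

theorem sum_dart [DecidableEq V] (φ : V → V → ℝ≥0∞) :
    ∑ e : G.Dart, φ e.fst e.snd = ∑ u, ∑ v ∈ G.neighborFinset u, φ u v := by
  have : ∀ u, ∑ v ∈ G.neighborFinset u, φ u v = ∑ v, if G.Adj u v then φ u v else 0 := by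
    intro u
    rw [← Finset.sum_filter]
    refine Finset.sum_congr ?_ fun _ _ => rfl
    ext v
    simp
  simp only [this]
  rw [← Fintype.sum_prod_type' fun u v => if G.Adj u v then φ u v else 0, ← Finset.sum_filter]
  refine Finset.sum_bij (fun e _ => e.toProd) ?_ ?_ ?_ ?_
  · intro e _
    simp [e.adj]
  · intro e _ e' _ h
    exact SimpleGraph.Dart.toProd_injective h
  · intro q hq
    exact ⟨⟨q, (Finset.mem_filter.1 hq).2⟩, Finset.mem_univ _, rfl⟩
  · intro e _
    rfl

theorem stationary_apply [Nonempty G.Dart] (u : V) :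
    stationary G u = (Fintype.card G.Dart : ℝ≥0∞)⁻¹ * G.degree u := by
  classical
  have h := sum_stationary_mul G fun v => if v = u then 1 else 0
  rw [Finset.sum_eq_single u (by simp +contextual) (by simp)] at h
  rw [if_pos rfl, mul_one] at h
  rw [h, ← SimpleGraph.dart_fst_fiber_card_eq_degree]
  simp

variable {G}

theorem graphWalk_apply {u : V} (h : 0 < G.degree u) (v : V) :
    graphWalk G u v = if G.Adj u v then (G.degree u : ℝ≥0∞)⁻¹ else 0 := by
  classical
  have h' : (G.neighborFinset u).Nonempty := by
    rwa [← Finset.card_pos, SimpleGraph.card_neighborFinset_eq_degree]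
  rw [graphWalk, dif_pos h', PMF.uniformOfFinset_apply]
  simp

/-- The degree cancels, so every oriented edge has the same mass. This gives reversibility and turns
the energy into a plain average over oriented edges. -/
theorem stationary_mul_graphWalk [Nonempty G.Dart] {u : V} (h : 0 < G.degree u) (v : V) :
    stationary G u * graphWalk G u v =
      if G.Adj u v then (Fintype.card G.Dart : ℝ≥0∞)⁻¹ else 0 := by
  rw [graphWalk_apply h, stationary_apply]
  split_ifs
  · rw [mul_assoc, ENNReal.mul_inv_cancel (by exact_mod_cast h.ne') (by simp), mul_one]
  · simp

theorem isReversible_graphWalk [Nonempty G.Dart] (h : ∀ u, 0 < G.degree u) :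
    IsReversible (graphWalk G) (stationary G) := by
  intro u v
  rw [stationary_mul_graphWalk (h u), stationary_mul_graphWalk (h v)]
  simp only [G.adj_comm]

theorem isErgodic_graphWalk (hG : G.Connected) (h : ∀ u, 0 < G.degree u) :
    IsErgodic (graphWalk G) := by
  intro u v
  have huv := (G.reachable_iff_reflTransGen u v).1 (hG.preconnected u v)
  induction huv with
  | refl => exact ⟨0, by simp [walkPow]⟩
  | @tail v w _ hvw ih =>
    obtain ⟨n, hn⟩ := ih
    refine ⟨n + 1, ?_⟩
    rw [walkPow, PMF.bind_apply]
    refine lt_of_lt_of_le ?_ (ENNReal.le_tsum v)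
    rw [graphWalk_apply (h v), if_pos hvw]
    exact ENNReal.mul_pos hn.ne' (by simp)

theorem card_dart_ne_zero [Nonempty G.Dart] : (Fintype.card G.Dart : ℝ≥0∞) ≠ 0 := by
  exact_mod_cast Fintype.card_ne_zero

/-- The Poincaré inequality of a finite graph, with sums over oriented edges. -/
theorem sum_dart_dart_le_localPoincareModulus {p σ : ℝ} (hp : 0 < p) {Y : Type*} [MetricSpace Y]
    [Nonempty G.Dart] (hG : G.Connected) (hdeg : ∀ u, 0 < G.degree u)
    (hgap : (σ : EReal) ≤ spectralGap (graphWalk G)) (f : V → Y) :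
    (Fintype.card G.Dart : ℝ≥0∞)⁻¹ *
        ∑ e : G.Dart, ∑ e' : G.Dart, edist (f e.fst) (f e'.fst) ^ p ≤
      localPoincareModulus p σ Y (Fintype.card V) ^ p *
        ∑ e : G.Dart, edist (f e.fst) (f e.snd) ^ p := by
  classical
  set D : ℝ≥0∞ := (Fintype.card G.Dart : ℝ≥0∞)⁻¹ with hD
  have hD0 : D ≠ 0 := by simp [hD]
  have hDt : D ≠ ⊤ := by rw [hD, Ne, ENNReal.inv_eq_top]; exact card_dart_ne_zero
  have hA : ∀ X : V → V → ℝ≥0∞, ∑ u, ∑ v, stationary G u * stationary G v * X u v =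
      D * (D * ∑ e : G.Dart, ∑ e' : G.Dart, X e.fst e'.fst) := by
    intro X
    simp only [mul_assoc, ← Finset.mul_sum]
    rw [sum_stationary_mul G fun u => ∑ v, stationary G v * X u v]
    simp only [sum_stationary_mul, ← Finset.mul_sum]
    rw [hD]
  have hB : ∀ X : V → V → ℝ≥0∞, ∑ u, ∑ v, stationary G u * graphWalk G u v * X u v =
      D * ∑ e : G.Dart, X e.fst e.snd := by
    intro X
    rw [sum_dart, Finset.mul_sum]
    refine Finset.sum_congr rfl fun u _ => ?_
    simp only [stationary_mul_graphWalk (hdeg u), Finset.mul_sum, ite_mul, zero_mul]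
    rw [← Finset.sum_filter]
    refine Finset.sum_congr ?_ fun _ _ => rfl
    ext v
    simp
  -- The range has at most as many points as the graph, so the local modulus suffices.
  let f' : V → Set.range f := Set.rangeFactorization f
  have hcard : (Set.range f).encard ≤ (Fintype.card V : ℕ) := by
    rw [← Set.image_univ]
    refine (Set.encard_image_le f _).trans ?_
    rw [Set.encard_univ, ENat.card_eq_coe_fintype_card]
  have hle : poincareModulus p σ (Set.range f) ≤ localPoincareModulus p σ Y (Fintype.card V) :=
    le_iSup₂_of_le (Set.range f) hcard le_rfl
  have key := poincareModulus_spec hp (graphWalk G) (stationary G) (isReversible_graphWalk hdeg)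
    (isErgodic_graphWalk hG hdeg) hgap f' ?_
  · rw [hA fun u v => edist (f' u) (f' v) ^ p, hB fun u v => edist (f' u) (f' v) ^ p,
      mul_left_comm (_ ^ p), ENNReal.mul_le_mul_iff_right hD0 hDt] at key
    exact key.trans (mul_le_mul_left (ENNReal.rpow_le_rpow hle hp.le) _)
  · rw [hA fun u v => edist (f' u) (f' v) ^ p, hB fun u v => edist (f' u) (f' v) ^ p]
    intro h
    -- Zero energy makes the function constant along edges, hence constant by connectedness.
    have h0 : ∀ u v, G.Adj u v → f' u = f' v := by
      intro u v huv
      have h1 := (mul_eq_zero.1 h).resolve_left hD0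
      have h2 := Finset.sum_eq_zero_iff.1 h1 ⟨(u, v), huv⟩ (Finset.mem_univ _)
      exact edist_eq_zero.1 ((ENNReal.rpow_eq_zero_iff_of_pos hp).1 h2)
    have h3 : ∀ u v, f' u = f' v := by
      intro u v
      have huv := (G.reachable_iff_reflTransGen u v).1 (hG.preconnected u v)
      induction huv with
      | refl => rfl
      | tail _ hvw ih => exact ih.trans (h0 _ _ hvw)
    simp [edist_eq_zero.2 (h3 _ _), hp]

end Graph

/-! ### Non-backtracking flows -/

/-- A permutation of the oriented edges of a graph which sends every oriented edge to one that
continues it without backtracking. -/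
structure NonBacktrackingFlow {V : Type*} (G : SimpleGraph V) where
  next : Equiv.Perm G.Dart
  next_fst : ∀ e, (next e).fst = e.snd
  next_snd_ne : ∀ e, (next e).snd ≠ e.fst

theorem exists_perm_forall_ne {A : Type*} [Fintype A] (h : 2 ≤ Fintype.card A) :
    ∃ s : Equiv.Perm A, ∀ a, s a ≠ a := by
  obtain ⟨n, hn⟩ := Nat.exists_eq_add_of_le' h
  let e : A ≃ Fin (n + 2) := Fintype.equivFinOfCardEq hn
  refine ⟨(e.trans (finRotate (n + 2))).trans e.symm, fun a ha => ?_⟩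
  have h1 : finRotate (n + 2) (e a) = e a := by
    simpa only [Equiv.trans_apply, Equiv.symm_apply_eq] using ha
  have h2 : e a ∈ (finRotate (n + 2)).support := by simp [support_finRotate]
  exact Equiv.Perm.mem_support.1 h2 h1

/-- A fixed-point-free permutation of the neighbors of each vertex matches incoming with outgoing
edges. Having no fixed point excludes backtracking; injectivity at each vertex makes the global map
a permutation. -/
theorem nonempty_nonBacktrackingFlow {V : Type*} [Fintype V] (G : SimpleGraph V)
    [DecidableRel G.Adj] (h : ∀ v, 2 ≤ G.degree v) : Nonempty (NonBacktrackingFlow G) := by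
  classical
  have hs : ∀ v, ∃ s : Equiv.Perm (G.neighborSet v), ∀ a, s a ≠ a := fun v =>
    exists_perm_forall_ne (by rw [SimpleGraph.card_neighborSet_eq_degree]; exact h v)
  choose s hs using hs
  let T : G.Dart → G.Dart := fun e => ⟨(e.snd, s e.snd ⟨e.fst, e.adj.symm⟩), (s e.snd _).2⟩
  have hT : Function.Injective T := by
    rintro ⟨⟨a, b⟩, hab⟩ ⟨⟨a', b'⟩, hab'⟩ hee
    have h1 : b = b' := congrArg (fun e : G.Dart => e.fst) hee
    subst h1
    have h2 := congrArg (fun e : G.Dart => e.snd) hee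
    have h3 := (s b).injective (Subtype.ext h2)
    have h4 : a = a' := congrArg Subtype.val h3
    subst h4
    rfl
  refine ⟨⟨Equiv.ofBijective T (Finite.injective_iff_bijective.1 hT), fun e => rfl, fun e => ?_⟩⟩
  exact fun he => hs e.snd ⟨e.fst, e.adj.symm⟩ (Subtype.ext he)

namespace NonBacktrackingFlow

variable {V : Type*} {G : SimpleGraph V} (T : NonBacktrackingFlow G)

/-- The `s`-th oriented edge of the trajectory of `e`. -/
def orbit (s : ℕ) (e : G.Dart) : G.Dart := (T.next ^ s) e

theorem orbit_succ (s : ℕ) (e : G.Dart) : T.orbit (s + 1) e = T.next (T.orbit s e) := by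
  rw [orbit, pow_succ']; rfl

theorem orbit_add (s t : ℕ) (e : G.Dart) : T.orbit (s + t) e = T.orbit s (T.orbit t e) := by
  rw [orbit, pow_add]; rfl

theorem orbit_bijective (s : ℕ) : Function.Bijective (T.orbit s) := (T.next ^ s).bijective

theorem orbit_succ_fst (s : ℕ) (e : G.Dart) : (T.orbit (s + 1) e).fst = (T.orbit s e).snd := by
  rw [orbit_succ, T.next_fst]

/-- The walk of length `n` along the trajectory of `e`. -/
def walk : ∀ (n : ℕ) (e : G.Dart), G.Walk e.fst (T.orbit n e).fst
  | 0, _ => .nil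
  | n + 1, e => .cons (v := (T.orbit 1 e).fst) (by rw [T.orbit_succ_fst]; exact e.adj)
      ((walk n (T.orbit 1 e)).copy rfl (by rw [← T.orbit_add]))

theorem length_walk (n : ℕ) (e : G.Dart) : (T.walk n e).length = n := by
  induction n generalizing e with
  | zero => rfl
  | succ n ih => simp [walk, ih]

theorem edges_walk (n : ℕ) (e : G.Dart) :
    (T.walk n e).edges = List.ofFn fun s : Fin n => (T.orbit s e).edge := by
  induction n generalizing e with
  | zero => rfl
  | succ n ih =>
    rw [walk, SimpleGraph.Walk.edges_cons, SimpleGraph.Walk.edges_copy, ih, List.ofFn_succ]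
    have h : ∀ s : ℕ, T.orbit s (T.orbit 1 e) = T.orbit (s + 1) e :=
      fun s => (T.orbit_add s 1 e).symm
    simp only [h, T.orbit_succ_fst 0]
    rfl

/-- A first return to the origin would close a cycle shorter than the girth, unless the closing edge
is already in the tail. A path can contain an edge at its starting vertex only as its first edge,
and that would be a backtrack. -/
theorem isPath_walk {n : ℕ} (hn : n < G.girth) (e : G.Dart) : (T.walk n e).IsPath := by
  classical
  induction n generalizing e with
  | zero => exact SimpleGraph.Walk.IsPath.nil
  | succ n ih =>
    have ih' := ih (Nat.lt_of_succ_lt hn) (T.orbit 1 e)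
    rw [walk, SimpleGraph.Walk.cons_isPath_iff]
    refine ⟨by simpa using ih', fun hmem => ?_⟩
    have hmem' : e.fst ∈ (T.walk n (T.orbit 1 e)).support := by simpa using hmem
    have hadj : G.Adj e.fst (T.orbit 1 e).fst := by rw [T.orbit_succ_fst]; exact e.adj
    set q := (T.walk n (T.orbit 1 e)).takeUntil e.fst hmem' with hq
    have hqp : q.IsPath := ih'.takeUntil hmem'
    have hlen : q.length ≤ n :=
      ((T.walk n (T.orbit 1 e)).length_takeUntil_le_length hmem').trans (T.length_walk _ _).le
    have hc : ¬ (SimpleGraph.Walk.cons hadj q).IsCycle := fun hc => by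
      have := SimpleGraph.girth_le_length hc
      rw [SimpleGraph.Walk.length_cons] at this
      omega
    rw [SimpleGraph.Walk.cons_isCycle_iff] at hc
    have hedge : s(e.fst, (T.orbit 1 e).fst) ∈ q.edges := by
      by_contra h
      exact hc ⟨hqp, h⟩
    have hedge' : s((T.orbit 1 e).fst, e.fst) ∈ (T.walk n (T.orbit 1 e)).edges := by
      rw [Sym2.eq_swap]
      exact SimpleGraph.Walk.edges_takeUntil_subset_edges _ hmem' hedge
    have hsnd := ih'.eq_snd_of_mem_edges hedge'
    cases n with
    | zero => exact absurd hedge' List.not_mem_nil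
    | succ n =>
      have h1 : (T.walk (n + 1) (T.orbit 1 e)).snd = (T.next e).snd := by
        rw [walk, SimpleGraph.Walk.snd_cons, T.orbit_succ_fst]
        rfl
      exact T.next_snd_ne e (h1.symm.trans hsnd.symm)

/-- This is how girth enters the probability: distinct edges carry independent words. -/
theorem injective_edge_orbit {n : ℕ} (hn : n < G.girth) (e : G.Dart) :
    Function.Injective fun s : Fin n => (T.orbit s e).edge := by
  rw [← List.nodup_ofFn, ← T.edges_walk]
  exact (T.isPath_walk hn e).isTrail.edges_nodup

end NonBacktrackingFlow

/-! ### Labels of oriented edges and the induced maps to the random group -/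

/-- The word read backwards with all letters inverted. -/
def Word.flip {k j : ℕ} (w : Word k j) : Word k j := fun i => ((w i.rev).1, !(w i.rev).2)

theorem Word.flip_flip {k j : ℕ} (w : Word k j) : w.flip.flip = w := by
  funext i
  simp [Word.flip]

theorem Word.eval_flip {k j : ℕ} (w : Word k j) : w.flip.eval = w.eval⁻¹ := by
  rw [Word.eval, Word.eval, FreeGroup.inv_mk]
  congr 1
  refine List.ext_getElem (by simp [FreeGroup.invRev]) fun n h1 h2 => ?_
  simp [FreeGroup.invRev, Word.flip, Fin.rev, Nat.sub_sub, Nat.add_comm]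

section Labels

variable {V : Type*} {H : SimpleGraph V} {k j : ℕ} (o : Orientation H) (α : H.edgeSet → Word k j)

open Classical in
/-- The word read along an oriented edge. -/
def dartWord (e : H.Dart) : Word k j :=
  if o.dart ⟨e.edge, e.edge_mem⟩ = e then α ⟨e.edge, e.edge_mem⟩
  else (α ⟨e.edge, e.edge_mem⟩).flip

theorem eval_dartWord (e : H.Dart) : (dartWord o α e).eval = label o α e := by
  rw [dartWord, label]
  split_ifs
  · rfl
  · exact Word.eval_flip _

theorem label_symm (e : H.Dart) : label o α e.symm = (label o α e)⁻¹ := by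
  have hx : (⟨e.symm.edge, e.symm.edge_mem⟩ : H.edgeSet) = ⟨e.edge, e.edge_mem⟩ :=
    Subtype.ext e.edge_symm
  rw [label, label, hx]
  have hd := o.edge_dart ⟨e.edge, e.edge_mem⟩
  rcases (SimpleGraph.dart_edge_eq_iff _ e).1 hd with h | h
  · rw [if_pos h, if_neg]
    rw [h]
    exact e.symm_ne.symm
  · rw [if_pos h, if_neg, inv_inv]
    rw [h]
    exact e.symm_ne

theorem pathLabel_cons {u v w : V} (h : H.Adj u v) (q : H.Walk v w) :
    pathLabel o α (.cons h q) = label o α ⟨(u, v), h⟩ * pathLabel o α q := by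
  simp [pathLabel]

theorem pathLabel_append {u v w : V} (q : H.Walk u v) (r : H.Walk v w) :
    pathLabel o α (q.append r) = pathLabel o α q * pathLabel o α r := by
  simp [pathLabel]

theorem pathLabel_reverse {u v : V} (q : H.Walk u v) :
    pathLabel o α q.reverse = (pathLabel o α q)⁻¹ := by
  induction q with
  | nil => simp [pathLabel]
  | cons h q ih =>
    rw [SimpleGraph.Walk.reverse_cons, pathLabel_append, ih, pathLabel_cons, pathLabel_cons,
      mul_inv_rev, ← label_symm]
    simp [pathLabel, SimpleGraph.Dart.symm]

/-- Following one path back and the other forth is a closed path, hence a relator. -/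
theorem mk_pathLabel_eq_of_endpoints {u v : V} (q r : H.Walk u v) :
    (QuotientGroup.mk (pathLabel o α q) : RGroup o α) = QuotientGroup.mk (pathLabel o α r) := by
  rw [QuotientGroup.eq, ← pathLabel_reverse, ← pathLabel_append]
  exact Subgroup.subset_normalClosure ⟨_, _, rfl⟩

/-- A connected graph mapping to the labeled graph maps to the random group, compatibly with the
labels. -/
theorem exists_potential {W : Type*} {G : SimpleGraph W} (hG : G.Connected) (ι : G →g H) :
    ∃ φ : W → RGroup o α, ∀ e : G.Dart,
      φ e.snd = φ e.fst * QuotientGroup.mk (label o α (ι.mapDart e)) := by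
  obtain ⟨b⟩ := hG.nonempty
  let q : ∀ v, G.Walk b v := fun v => (hG.preconnected b v).some
  refine ⟨fun v => QuotientGroup.mk (pathLabel o α ((q v).map ι)), fun e => ?_⟩
  rw [← QuotientGroup.mk_mul]
  have h : pathLabel o α ((q e.fst).map ι) * label o α (ι.mapDart e) =
      pathLabel o α (((q e.fst).map ι).append (.cons (ι.map_adj e.adj) .nil)) := by
    rw [pathLabel_append, pathLabel_cons]
    simp [pathLabel]
    rfl
  rw [h]
  exact mk_pathLabel_eq_of_endpoints o α _ _

/-- The words read along the first `m` oriented edges of a trajectory. -/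
def orbitWords {W : Type*} {G : SimpleGraph W} (ι : G →g H) (T : NonBacktrackingFlow G) (m : ℕ)
    (e : G.Dart) : Fin m → Word k j := fun s => dartWord o α (ι.mapDart (T.orbit s e))

theorem potential_orbit {W : Type*} {G : SimpleGraph W} {ι : G →g H} {φ : W → RGroup o α}
    (hφ : ∀ e : G.Dart, φ e.snd = φ e.fst * QuotientGroup.mk (label o α (ι.mapDart e)))
    (T : NonBacktrackingFlow G) (m : ℕ) (e : G.Dart) :
    φ (T.orbit m e).fst = φ e.fst *
      QuotientGroup.mk (List.ofFn fun s => (orbitWords o α ι T m e s).eval).prod := by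
  induction m with
  | zero => simp [NonBacktrackingFlow.orbit]
  | succ m ih =>
    rw [T.orbit_succ_fst, hφ, ih, List.ofFn_succ', mul_assoc, ← QuotientGroup.mk_mul]
    simp only [orbitWords, eval_dartWord, List.concat_eq_append, List.prod_append,
      List.prod_singleton]
    rfl

/-- Equivariance and isometry cancel the starting point, so the displacement depends only on the
words read. -/
theorem edist_potential_orbit {W : Type*} {G : SimpleGraph W} {ι : G →g H} {φ : W → RGroup o α}
    (hφ : ∀ e : G.Dart, φ e.snd = φ e.fst * QuotientGroup.mk (label o α (ι.mapDart e)))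
    (T : NonBacktrackingFlow G) (m : ℕ) (e : G.Dart) {Y : Type*} [MetricSpace Y]
    [MulAction (RGroup o α) Y] [IsIsometricSMul (RGroup o α) Y] {f : RGroup o α → Y}
    (hf : ∀ g x, f (g * x) = g • f x) :
    edist (f (φ e.fst)) (f (φ (T.orbit m e).fst)) = edist (f 1)
      (f (QuotientGroup.mk (List.ofFn fun s => (orbitWords o α ι T m e s).eval).prod)) := by
  rw [potential_orbit o α hφ, hf, ← mul_one (φ e.fst), hf, mul_one, edist_smul_left]

end Labels

/-! ### Comparison of energies for balanced labelings -/

/-- Transporting one endpoint by a permutation costs at most a factor `2 ^ p` over the average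
over all pairs. -/
theorem sum_edist_perm_le {I Y : Type*} [Fintype I] [MetricSpace Y] {p : ℝ} (hp : 1 ≤ p)
    (x : I → Y) {s : I → I} (hs : Function.Bijective s) :
    (Fintype.card I : ℝ≥0∞) * ∑ i, edist (x i) (x (s i)) ^ p ≤
      2 ^ p * ∑ i, ∑ i', edist (x i) (x i') ^ p := by
  have h : ∀ i i', edist (x i) (x (s i)) ^ p ≤
      2 ^ (p - 1) * (edist (x i) (x i') ^ p + edist (x i') (x (s i)) ^ p) := fun i i' =>
    (ENNReal.rpow_le_rpow (edist_triangle _ (x i') _) (by linarith)).trans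
      (ENNReal.rpow_add_le_mul_rpow_add_rpow _ _ hp)
  -- Bijectivity of `s` makes both legs of the triangle contribute the same double sum.
  have h2 : ∑ i, ∑ i', edist (x i') (x (s i)) ^ p = ∑ i, ∑ i', edist (x i) (x i') ^ p := by
    rw [hs.sum_comp fun i => ∑ i', edist (x i') (x i) ^ p]
    simp only [edist_comm]
  calc (Fintype.card I : ℝ≥0∞) * ∑ i, edist (x i) (x (s i)) ^ p
      = ∑ i, ∑ _i' : I, edist (x i) (x (s i)) ^ p := by
        simp [Finset.mul_sum]
    _ ≤ ∑ i, ∑ i', 2 ^ (p - 1) * (edist (x i) (x i') ^ p + edist (x i') (x (s i)) ^ p) :=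
        Finset.sum_le_sum fun i _ => Finset.sum_le_sum fun i' _ => h i i'
    _ = 2 ^ p * ∑ i, ∑ i', edist (x i) (x i') ^ p := by
        simp only [← Finset.mul_sum, Finset.sum_add_distrib, h2]
        rw [← two_mul, ← mul_assoc]
        congr 1
        conv_lhs => rw [← ENNReal.rpow_one 2, ← ENNReal.rpow_mul, one_mul]
        rw [← ENNReal.rpow_add _ _ (by simp) (by simp), sub_add_cancel]

section

variable {V : Type*} {H : SimpleGraph V} {k j : ℕ} (o : Orientation H)
  (α : H.edgeSet → Word k j) {W : Type*} [Fintype W] {G : SimpleGraph W} [DecidableRel G.Adj]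

open Classical in
/-- The number of trajectories of length `m` along which the given words are read. -/
def orbitCount (ι : G →g H) (T : NonBacktrackingFlow G) (m : ℕ) (ω : Fin m → Word k j) : ℕ :=
  Fintype.card {e : G.Dart // orbitWords o α ι T m e = ω}

theorem sum_orbitWords (ι : G →g H) (T : NonBacktrackingFlow G) (m : ℕ)
    (g : (Fin m → Word k j) → ℝ≥0∞) :
    ∑ e : G.Dart, g (orbitWords o α ι T m e) =
      ∑ ω, (orbitCount o α ι T m ω : ℝ≥0∞) * g ω := by
  classical
  rw [← Finset.sum_fiberwise (s := Finset.univ) (g := orbitWords o α ι T m)]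
  refine Finset.sum_congr rfl fun ω _ => ?_
  rw [orbitCount, Fintype.card_subtype, ← nsmul_eq_mul, ← Finset.sum_const]
  refine Finset.sum_congr (by congr!) fun e he => ?_
  rw [(Finset.mem_filter.1 he).2]

/-- A labeling is balanced at length `m` if every `m`-tuple of words is read along at least half
as many trajectories as expected, and every word is the label of at most twice as many oriented
edges as expected. -/
def IsBalanced (ι : G →g H) (T : NonBacktrackingFlow G) (m : ℕ) : Prop :=
  (∀ ω, Fintype.card G.Dart ≤ 2 * (orbitCount o α ι T m ω * Fintype.card (Word k j) ^ m)) ∧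
  ∀ ω, orbitCount o α ι T 1 ω * Fintype.card (Word k j) ^ 1 ≤ 2 * Fintype.card G.Dart

/-- Tree energies are averages over words, graph energies averages over trajectories; balance
compares them in the direction needed at each of the lengths `m` and `1`. -/
theorem energy_le_of_isBalanced [NeZero k] {p σ : ℝ} (hp : 1 ≤ p) [Nonempty G.Dart] (hG : G.Connected)
    (hdeg : ∀ u, 0 < G.degree u) (hgap : (σ : EReal) ≤ spectralGap (graphWalk G))
    (ι : G →g H) (T : NonBacktrackingFlow G) {m : ℕ} (hα : IsBalanced o α ι T m)
    {Y : Type*} [MetricSpace Y] [MulAction (RGroup o α) Y] [IsIsometricSMul (RGroup o α) Y]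
    {f : RGroup o α → Y} (hf : ∀ g x, f (g * x) = g • f x) :
    energy p (walkPow (treeWalk k) (j * m)) (fun x : FreeGroup (Fin k) => f (QuotientGroup.mk x)) ≤
      2 ^ (p + 2) * localPoincareModulus p σ Y (Fintype.card W) ^ p *
        energy p (walkPow (treeWalk k) j) (fun x : FreeGroup (Fin k) => f (QuotientGroup.mk x)) := by
  obtain ⟨φ, hφ⟩ := exists_potential o α hG ι
  set L := localPoincareModulus p σ Y (Fintype.card W) ^ p
  set D : ℝ≥0∞ := (Fintype.card G.Dart : ℝ≥0∞) with hD
  set Q : ℝ≥0∞ := (Fintype.card (Word k j) : ℝ≥0∞) with hQ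
  have hD0 : D ≠ 0 := card_dart_ne_zero
  have hDt : D ≠ ⊤ := by simp [hD]
  have hQ0 : Q ≠ 0 := Nat.cast_ne_zero.2 Fintype.card_ne_zero
  have hQt : Q ≠ ⊤ := ENNReal.natCast_ne_top _
  let g : ∀ n, (Fin n → Word k j) → ℝ≥0∞ := fun n ω =>
    edist (f 1) (f (QuotientGroup.mk (List.ofFn fun i => (ω i).eval).prod)) ^ p
  -- The displacement under `n` steps of the flow; `E 1` is exactly the edge energy on the graph,
  -- since one step leads to the other endpoint.
  let E : ℕ → ℝ≥0∞ := fun n => ∑ e : G.Dart, edist (f (φ e.fst)) (f (φ (T.orbit n e).fst)) ^ p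
  have hE : ∀ n, E n = ∑ ω, (orbitCount o α ι T n ω : ℝ≥0∞) * g n ω := by
    intro n
    rw [← sum_orbitWords]
    exact Finset.sum_congr rfl fun e _ => by rw [edist_potential_orbit o α hφ T n e hf]
  have hen : ∀ n, energy p (walkPow (treeWalk k) (j * n))
      (fun x : FreeGroup (Fin k) => f (QuotientGroup.mk x)) =
      2⁻¹ * ((Q⁻¹) ^ n * ∑ ω, g n ω) := fun n => energy_walkPow_treeWalk p j n _
  have h1 : D * ∑ ω, g m ω ≤ 2 * Q ^ m * E m := by
    rw [hE, Finset.mul_sum, Finset.mul_sum]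
    refine Finset.sum_le_sum fun ω _ => ?_
    have : D ≤ 2 * (orbitCount o α ι T m ω * Q ^ m) := by
      have := hα.1 ω
      rw [hD, hQ]
      exact_mod_cast this
    calc D * g m ω ≤ 2 * (orbitCount o α ι T m ω * Q ^ m) * g m ω := by gcongr
      _ = _ := by ring
  have h2 : D * E m ≤ 2 ^ p * ∑ e : G.Dart, ∑ e' : G.Dart, edist (f (φ e.fst)) (f (φ e'.fst)) ^ p :=
    sum_edist_perm_le hp (fun e : G.Dart => f (φ e.fst)) (T.orbit_bijective m)
  have h3 : D⁻¹ * ∑ e : G.Dart, ∑ e' : G.Dart, edist (f (φ e.fst)) (f (φ e'.fst)) ^ p ≤ L * E 1 := by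
    have := sum_dart_dart_le_localPoincareModulus (by linarith) hG hdeg hgap fun v => f (φ v)
    refine this.trans_eq ?_
    congr 1
    refine Finset.sum_congr rfl fun e _ => ?_
    rw [T.orbit_succ_fst 0]
    rfl
  have h4 : Q * E 1 ≤ 2 * D * ∑ ω, g 1 ω := by
    rw [hE, Finset.mul_sum, Finset.mul_sum]
    refine Finset.sum_le_sum fun ω _ => ?_
    have : orbitCount o α ι T 1 ω * Q ≤ 2 * D := by
      have := hα.2 ω
      rw [pow_one] at this
      rw [hD, hQ]
      exact_mod_cast this
    calc Q * (orbitCount o α ι T 1 ω * g 1 ω) = orbitCount o α ι T 1 ω * Q * g 1 ω := by ring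
      _ ≤ _ := by gcongr
  have hDD : D⁻¹ * D = 1 := ENNReal.inv_mul_cancel hD0 hDt
  have hQQ : Q⁻¹ * Q = 1 := ENNReal.inv_mul_cancel hQ0 hQt
  have h1' : (Q⁻¹) ^ m * ∑ ω, g m ω ≤ 2 * (D⁻¹ * E m) := by
    calc (Q⁻¹) ^ m * ∑ ω, g m ω = (Q⁻¹) ^ m * D⁻¹ * (D * ∑ ω, g m ω) := by
          rw [mul_assoc, ← mul_assoc D⁻¹, hDD, one_mul]
      _ ≤ (Q⁻¹) ^ m * D⁻¹ * (2 * Q ^ m * E m) := by gcongr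
      _ = (Q⁻¹ * Q) ^ m * (2 * (D⁻¹ * E m)) := by rw [mul_pow]; ring
      _ = _ := by rw [hQQ, one_pow, one_mul]
  have h2' : E m ≤ 2 ^ p * (L * E 1) := by
    calc E m = D⁻¹ * (D * E m) := by rw [← mul_assoc, hDD, one_mul]
      _ ≤ D⁻¹ * (2 ^ p * ∑ e : G.Dart, ∑ e' : G.Dart,
            edist (f (φ e.fst)) (f (φ e'.fst)) ^ p) := by gcongr
      _ = 2 ^ p * (D⁻¹ * ∑ e : G.Dart, ∑ e' : G.Dart,
            edist (f (φ e.fst)) (f (φ e'.fst)) ^ p) := by ring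
      _ ≤ _ := by gcongr
  have h4' : D⁻¹ * E 1 ≤ 2 * (Q⁻¹ * ∑ ω, g 1 ω) := by
    calc D⁻¹ * E 1 = D⁻¹ * Q⁻¹ * (Q * E 1) := by rw [mul_assoc, ← mul_assoc Q⁻¹, hQQ, one_mul]
      _ ≤ D⁻¹ * Q⁻¹ * (2 * D * ∑ ω, g 1 ω) := by gcongr
      _ = D⁻¹ * D * (2 * (Q⁻¹ * ∑ ω, g 1 ω)) := by ring
      _ = _ := by rw [hDD, one_mul]
  have hen1 := hen 1
  rw [mul_one, pow_one] at hen1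
  -- One factor `2` comes from each half of balance, and `2 ^ p` from the triangle inequality.
  have h22 : (2 : ℝ≥0∞) ^ (p + 2) = 2 * 2 ^ p * 2 := by
    rw [ENNReal.rpow_add _ _ (by simp) (by simp), ENNReal.rpow_ofNat]
    ring
  rw [hen, hen1, h22]
  calc 2⁻¹ * ((Q⁻¹) ^ m * ∑ ω, g m ω) ≤ 2⁻¹ * (2 * (D⁻¹ * E m)) := by gcongr
    _ ≤ 2⁻¹ * (2 * (D⁻¹ * (2 ^ p * (L * E 1)))) := by gcongr
    _ = 2⁻¹ * (2 * (2 ^ p * (L * (D⁻¹ * E 1)))) := by ring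
    _ ≤ 2⁻¹ * (2 * (2 ^ p * (L * (2 * (Q⁻¹ * ∑ ω, g 1 ω))))) := by gcongr
    _ = _ := by ring

end

/-! ### Random labelings are balanced -/

open Classical in
/-- Chebyshev's inequality for the number of events that occur, among events of equal
probability `p` each of which is independent of all but `r` of them. -/
theorem measureReal_card_deviation_le {Ω : Type*} [MeasurableSpace Ω] (μ : Measure Ω)
    [IsProbabilityMeasure μ] {I : Type*} [Fintype I] [Nonempty I] (A : I → Set Ω)
    (hA : ∀ i, MeasurableSet (A i)) {p : ℝ} (hp0 : 0 < p) (hp : ∀ i, μ.real (A i) = p)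
    (R : I → I → Prop) (hR : ∀ i i', ¬ R i i' → μ.real (A i ∩ A i') = p ^ 2) {r : ℕ}
    (hr : ∀ i, Fintype.card {i' // R i i'} ≤ r) :
    μ.real {ω | Fintype.card I * p / 2 ≤ |(Fintype.card {i // ω ∈ A i} : ℝ) - Fintype.card I * p|} ≤
      4 * r / (Fintype.card I * p) := by
  set c : ℝ := (Fintype.card I : ℝ) with hc
  have hc0 : 0 < c := by rw [hc]; exact_mod_cast Fintype.card_pos
  let one : I → Ω → ℝ := fun i => (A i).indicator 1
  have hone : ∀ i, Integrable (one i) μ := fun i => (integrable_const (1 : ℝ)).indicator (hA i)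
  have hmul : ∀ i i', (fun ω => one i ω * one i' ω) = (A i ∩ A i').indicator 1 := by
    intro i i'
    rw [Set.inter_indicator_one]
    rfl
  have hmuli : ∀ i i', Integrable (fun ω => one i ω * one i' ω) μ := by
    intro i i'
    rw [hmul]
    exact (integrable_const (1 : ℝ)).indicator ((hA i).inter (hA i'))
  let X : Ω → ℝ := fun ω => ∑ i, (one i ω - p)
  have hX : ∀ ω, X ω = (Fintype.card {i // ω ∈ A i} : ℝ) - c * p := by
    intro ω
    simp only [X, one, Finset.sum_sub_distrib, Finset.sum_const, Finset.card_univ, nsmul_eq_mul,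
      ← hc]
    congr 1
    simp [Set.indicator_apply, Fintype.card_subtype]
  have hterm : ∀ i i' ω, (one i ω - p) * (one i' ω - p) =
      one i ω * one i' ω - p * one i ω - p * one i' ω + p ^ 2 := fun i i' ω => by ring
  have hint : ∀ i i', Integrable (fun ω => (one i ω - p) * (one i' ω - p)) μ := by
    intro i i'
    simp only [hterm]
    exact (((hmuli i i').sub ((hone i).const_mul p)).sub ((hone i').const_mul p)).add
      (integrable_const _)
  have hcov : ∀ i i', ∫ ω, (one i ω - p) * (one i' ω - p) ∂μ = μ.real (A i ∩ A i') - p ^ 2 := by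
    intro i i'
    simp only [hterm]
    have h1 : Integrable (fun ω => one i ω * one i' ω - p * one i ω) μ :=
      (hmuli i i').sub ((hone i).const_mul p)
    have h2 : Integrable (fun ω => one i ω * one i' ω - p * one i ω - p * one i' ω) μ :=
      h1.sub ((hone i').const_mul p)
    rw [integral_add h2 (integrable_const _), integral_sub h1 ((hone i').const_mul p),
      integral_sub (hmuli i i') ((hone i).const_mul p), integral_const_mul, integral_const_mul,
      hmul, integral_indicator_one ((hA i).inter (hA i')), integral_indicator_one (hA i),
      integral_indicator_one (hA i'), hp, hp]
    simp
    ring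
  have hsq : ∀ ω, X ω ^ 2 = ∑ i, ∑ i', (one i ω - p) * (one i' ω - p) := by
    intro ω
    rw [sq, Finset.sum_mul_sum]
  have hsqi : Integrable (fun ω => X ω ^ 2) μ := by
    simp only [hsq]
    exact integrable_finsetSum _ fun i _ => integrable_finsetSum _ fun i' _ => hint i i'
  have hvar : ∫ ω, X ω ^ 2 ∂μ ≤ c * (r * p) := by
    simp only [hsq]
    rw [integral_finsetSum _ fun i _ => integrable_finsetSum _ fun i' _ => hint i i']
    have hi : ∀ i, ∫ ω, ∑ i', (one i ω - p) * (one i' ω - p) ∂μ ≤ r * p := by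
      intro i
      rw [integral_finsetSum _ fun i' _ => hint i i']
      calc ∑ i', ∫ ω, (one i ω - p) * (one i' ω - p) ∂μ
          ≤ ∑ i', if R i i' then p else 0 := by
            refine Finset.sum_le_sum fun i' _ => ?_
            rw [hcov]
            split_ifs with h
            -- A related pair has covariance at most `p`; unrelated pairs contribute nothing, so the
            -- variance is at most `r` times the mean.
            · have : μ.real (A i ∩ A i') ≤ p :=
                (measureReal_mono Set.inter_subset_left).trans_eq (hp i)
              nlinarith [sq_nonneg p]
            · rw [hR i i' h, sub_self]
        _ = (Fintype.card {i' // R i i'} : ℝ) * p := by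
            rw [← Finset.sum_filter, Finset.sum_const, nsmul_eq_mul, Fintype.card_subtype]
        _ ≤ r * p := by
            gcongr
            exact_mod_cast hr i
    calc _ ≤ ∑ _i : I, (r * p : ℝ) := Finset.sum_le_sum fun i _ => hi i
      _ = c * (r * p) := by simp [hc]
  have hmarkov := mul_meas_ge_le_integral_of_nonneg (μ := μ) (f := fun ω => X ω ^ 2)
    (Filter.Eventually.of_forall fun ω => sq_nonneg _) hsqi ((c * p / 2) ^ 2)
  have hset : {ω | c * p / 2 ≤ |(Fintype.card {i // ω ∈ A i} : ℝ) - c * p|} =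
      {ω | (c * p / 2) ^ 2 ≤ X ω ^ 2} := by
    ext ω
    rw [Set.mem_ofPred_eq, Set.mem_ofPred_eq, sq_le_sq, hX, abs_of_pos (by positivity : 0 < c * p / 2)]
  rw [hset, le_div_iff₀ (by positivity)]
  have hcp : 0 < c * p := by positivity
  have h := hmarkov.trans hvar
  have h2 : c * p * (μ.real {ω | (c * p / 2) ^ 2 ≤ X ω ^ 2} * (c * p)) ≤ c * p * (4 * r) := by
    nlinarith
  exact le_of_mul_le_mul_left h2 hcp

/-! ### Independence of the words and concentration of trajectory counts -/

section

variable {V : Type*} {H : SimpleGraph V} {k j : ℕ} (o : Orientation H)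

/-- Reversal of words is an involution, so prescribing the word along an oriented edge prescribes
the value of `α` on the edge. -/
theorem dartWord_eq_iff (α : H.edgeSet → Word k j) (e : H.Dart) (w : Word k j) :
    dartWord o α e = w ↔ α ⟨e.edge, e.edge_mem⟩ = dartWord o (fun _ => w) e := by
  rw [dartWord, dartWord]
  split_ifs
  · rfl
  · constructor
    · rintro rfl
      exact (Word.flip_flip _).symm
    · intro h
      rw [h, Word.flip_flip]

/-- The words on finitely many different edges are independent and uniform. -/
theorem labelMeasure_dartWord [NeZero k] {S : Type*} [Fintype S] (d : S → H.Dart)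
    (hd : Function.Injective fun s => (d s).edge) (ω : S → Word k j) :
    MeasurableSet {α | ∀ s, dartWord o α (d s) = ω s} ∧
    (labelMeasure H k j).real {α | ∀ s, dartWord o α (d s) = ω s} =
      ((Fintype.card (Word k j) : ℝ)⁻¹) ^ Fintype.card S := by
  let ε : S → H.edgeSet := fun s => ⟨(d s).edge, (d s).edge_mem⟩
  have hε : Function.Injective ε := fun s t h => hd (congrArg Subtype.val h)
  let τ : S → Word k j := fun s => dartWord o (fun _ => ω s) (d s)
  have hset : {α | ∀ s, dartWord o α (d s) = ω s} =
      (fun (α : H.edgeSet → Word k j) s => α (ε s)) ⁻¹' {τ} := by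
    ext α
    rw [Set.mem_preimage, Set.mem_singleton_iff, funext_iff]
    exact forall_congr' fun s => dartWord_eq_iff o α (d s) (ω s)
  have hm : Measurable fun (α : H.edgeSet → Word k j) s => α (ε s) :=
    measurable_pi_lambda _ fun s => measurable_pi_apply _
  rw [hset]
  refine ⟨hm (measurableSet_singleton _), ?_⟩
  rw [measureReal_def, ← Measure.map_apply hm (measurableSet_singleton _), labelMeasure,
    Measure.map_infinitePi_infinitePi_of_inj hε, Measure.infinitePi_singleton_of_fintype]
  simp only [PMF.toMeasure_apply_singleton _ _ (measurableSet_singleton _),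
    PMF.uniformOfFintype_apply]
  simp

variable {W : Type*} [Fintype W] {G : SimpleGraph W} [DecidableRel G.Adj]

open Classical in
-- The two positions of a shared edge and its direction determine `e'`: run the flow backwards from
-- that edge.
theorem card_orbit_meet_le (T : NonBacktrackingFlow G) (m : ℕ) (e : G.Dart) :
    Fintype.card {e' // ∃ s t : Fin m, (T.orbit s e).edge = (T.orbit t e').edge} ≤ 2 * m ^ 2 := by
  let F : Fin m × Fin m × Bool → G.Dart := fun x =>
    (T.next ^ (x.2.1 : ℕ)).symm (if x.2.2 then T.orbit x.1 e else (T.orbit x.1 e).symm)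
  have hF : Finset.univ.filter (fun e' => ∃ s t : Fin m, (T.orbit s e).edge = (T.orbit t e').edge) ⊆
      Finset.univ.image F := by
    intro e' he'
    obtain ⟨s, t, hst⟩ := (Finset.mem_filter.1 he').2
    rw [Finset.mem_image]
    rcases (SimpleGraph.dart_edge_eq_iff _ _).1 hst.symm with h | h
    · exact ⟨(s, t, true), Finset.mem_univ _, by simp [F, Equiv.symm_apply_eq, ← h]; rfl⟩
    · exact ⟨(s, t, false), Finset.mem_univ _, by simp [F, Equiv.symm_apply_eq, ← h]; rfl⟩
  rw [Fintype.card_subtype]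
  refine (Finset.card_le_card hF).trans (Finset.card_image_le.trans_eq ?_)
  simp
  ring

/-- The number of trajectories along which given words are read is concentrated. -/
theorem measureReal_orbitCount_deviation_le [NeZero k] [Nonempty G.Dart] {ι : G →g H}
    (hι : Function.Injective ι) (T : NonBacktrackingFlow G) {m : ℕ} (hm : m < G.girth)
    (ω : Fin m → Word k j) :
    (labelMeasure H k j).real {α | Fintype.card G.Dart * ((Fintype.card (Word k j) : ℝ)⁻¹) ^ m / 2 ≤
      |(orbitCount o α ι T m ω : ℝ) -
        Fintype.card G.Dart * ((Fintype.card (Word k j) : ℝ)⁻¹) ^ m|} ≤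
      8 * m ^ 2 * Fintype.card (Word k j) ^ m / Fintype.card G.Dart := by
  classical
  have hQ : (0 : ℝ) < Fintype.card (Word k j) := by exact_mod_cast Fintype.card_pos
  have hinj : ∀ e : G.Dart, Function.Injective fun s : Fin m => (ι.mapDart (T.orbit s e)).edge :=
    fun e => (Sym2.map.injective hι).comp (T.injective_edge_orbit hm e)
  let A : G.Dart → Set (H.edgeSet → Word k j) := fun e =>
    {α | ∀ s : Fin m, dartWord o α (ι.mapDart (T.orbit s e)) = ω s}
  have hA := fun e => labelMeasure_dartWord o (fun s : Fin m => ι.mapDart (T.orbit s e)) (hinj e) ω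
  have key := measureReal_card_deviation_le (labelMeasure H k j) A (fun e => (hA e).1)
    (p := ((Fintype.card (Word k j) : ℝ)⁻¹) ^ m) (by positivity)
    (fun e => by rw [(hA e).2, Fintype.card_fin])
    (fun e e' => ∃ s t : Fin m, (T.orbit s e).edge = (T.orbit t e').edge) ?_
    (fun e => by convert card_orbit_meet_le T m e)
  · have hcount : ∀ α, orbitCount o α ι T m ω = Fintype.card {e // α ∈ A e} := by
      intro α
      rw [orbitCount]
      refine Fintype.card_congr (Equiv.subtypeEquivRight fun e => ?_)
      simp only [A, Set.mem_ofPred_eq, funext_iff, orbitWords]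
    simp only [hcount]
    refine (le_of_eq ?_).trans (key.trans_eq ?_)
    · congr!
    · rw [inv_pow, ← div_eq_mul_inv, div_div_eq_mul_div, Nat.cast_mul, Nat.cast_pow,
        Nat.cast_ofNat]
      ring
  -- With no common edge, the two trajectories read `2m` words on distinct edges, so the joint
  -- probability is the square.
  · intro e e' h
    push Not at h
    have := (labelMeasure_dartWord o
      (Sum.elim (fun s : Fin m => ι.mapDart (T.orbit s e))
        fun s : Fin m => ι.mapDart (T.orbit s e')) ?_ (Sum.elim ω ω)).2
    · rw [Fintype.card_sum, Fintype.card_fin, ← two_mul, mul_comm, pow_mul] at this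
      rw [← this]
      congr 1
      ext α
      simp [A]
    · have : (fun s => (Sum.elim (fun s : Fin m => ι.mapDart (T.orbit s e))
          (fun s : Fin m => ι.mapDart (T.orbit s e')) s).edge) =
          Sum.elim (fun s : Fin m => (ι.mapDart (T.orbit s e)).edge)
            fun s : Fin m => (ι.mapDart (T.orbit s e')).edge := by
        funext s
        cases s <;> rfl
      rw [this]
      refine (hinj e).sumElim (hinj e') fun s t hst => h s t ?_
      exact Sym2.map.injective hι hst

end

/-! ### Probability that a labeling is not balanced -/

section

variable {V : Type*} {H : SimpleGraph V} {k j : ℕ} [NeZero k] (o : Orientation H)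
  {W : Type*} [Fintype W] {G : SimpleGraph W} [DecidableRel G.Adj]

/-- Failure of balance forces some count at length `m` or `1` to deviate from its mean by at least
half of it. The union over the `Q ^ m` tuples of words costs the second factor `Q ^ m`. -/
theorem measureReal_not_isBalanced_le [Nonempty G.Dart] {ι : G →g H}
    (hι : Function.Injective ι) (T : NonBacktrackingFlow G) {m : ℕ} (hm0 : 0 < m)
    (hm : m < G.girth) :
    (labelMeasure H k j).real {α | ¬ IsBalanced o α ι T m} ≤
      16 * m ^ 2 * (Fintype.card (Word k j) : ℝ) ^ (2 * m) / Fintype.card G.Dart := by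
  set Q : ℝ := (Fintype.card (Word k j) : ℝ) with hQ
  set D : ℝ := (Fintype.card G.Dart : ℝ) with hD
  have hQ1 : 1 ≤ Q := by rw [hQ]; exact_mod_cast Fintype.card_pos
  have hD0 : 0 < D := by rw [hD]; exact_mod_cast Fintype.card_pos
  let B : ∀ n, (Fin n → Word k j) → Set (H.edgeSet → Word k j) := fun n ω =>
    {α | D * Q⁻¹ ^ n / 2 ≤ |(orbitCount o α ι T n ω : ℝ) - D * Q⁻¹ ^ n|}
  have hB : ∀ n, n < G.girth → (labelMeasure H k j).real (⋃ ω, B n ω) ≤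
      8 * n ^ 2 * Q ^ (2 * n) / D := by
    intro n hn
    refine (measureReal_iUnion_fintype_le _).trans ?_
    refine (Finset.sum_le_sum fun ω _ =>
      measureReal_orbitCount_deviation_le o hι T hn ω).trans_eq ?_
    rw [Finset.sum_const, Finset.card_univ, Fintype.card_fun, Fintype.card_fin, nsmul_eq_mul]
    rw [Nat.cast_pow, ← hQ, two_mul, pow_add]
    ring
  have hsub : {α | ¬ IsBalanced o α ι T m} ⊆ (⋃ ω, B m ω) ∪ ⋃ ω, B 1 ω := by
    intro α hα
    have hα' : ¬ IsBalanced o α ι T m := hα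
    rw [IsBalanced, not_and_or] at hα'
    push Not at hα'
    have hp : ∀ n : ℕ, 0 < Q⁻¹ ^ n := fun n => by positivity
    have hpQ : ∀ n : ℕ, Q ^ n * Q⁻¹ ^ n = 1 := fun n => by
      rw [← mul_pow, mul_inv_cancel₀ (by positivity), one_pow]
    rcases hα' with ⟨ω, hω⟩ | ⟨ω, hω⟩
    · refine Or.inl (Set.mem_iUnion.2 ⟨ω, ?_⟩)
      have h : 2 * ((orbitCount o α ι T m ω : ℝ) * Q ^ m) < D := by
        rw [hD, hQ]; exact_mod_cast hω
      have h2 := mul_lt_mul_of_pos_right h (hp m)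
      have h3 : 2 * ((orbitCount o α ι T m ω : ℝ) * Q ^ m) * Q⁻¹ ^ m =
          2 * orbitCount o α ι T m ω := by
        rw [mul_assoc, mul_assoc, hpQ, mul_one]
      refine (le_abs (α := ℝ)).2 (Or.inr ?_)
      linarith
    · refine Or.inr (Set.mem_iUnion.2 ⟨ω, ?_⟩)
      have h : 2 * D < (orbitCount o α ι T 1 ω : ℝ) * Q ^ 1 := by
        rw [hD, hQ]; exact_mod_cast hω
      have h2 := mul_lt_mul_of_pos_right h (hp 1)
      rw [mul_assoc, mul_assoc, hpQ, mul_one] at h2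
      have h4 := mul_pos hD0 (hp 1)
      refine (le_abs (α := ℝ)).2 (Or.inl ?_)
      linarith
  -- The bound at length `1` is absorbed by the one at length `m`.
  have h1 : 8 * ((1 : ℕ) : ℝ) ^ 2 * Q ^ (2 * 1) / D ≤ 8 * m ^ 2 * Q ^ (2 * m) / D := by
    have : (1 : ℝ) ≤ m := by exact_mod_cast hm0
    gcongr
    · exact_mod_cast hm0
    · exact hm0
  calc _ ≤ (labelMeasure H k j).real (⋃ ω, B m ω) + (labelMeasure H k j).real (⋃ ω, B 1 ω) :=
        (measureReal_mono hsub).trans (measureReal_union_le _ _)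
    _ ≤ 8 * m ^ 2 * Q ^ (2 * m) / D + 8 * m ^ 2 * Q ^ (2 * m) / D :=
        add_le_add (hB m hm) ((hB 1 (lt_of_le_of_lt hm0 hm)).trans h1)
    _ = _ := by ring

theorem card_le_card_dart (h : ∀ u, 0 < G.degree u) : Fintype.card W ≤ Fintype.card G.Dart := by
  rw [SimpleGraph.dart_card_eq_sum_degrees, ← Finset.card_univ, Finset.card_eq_sum_ones]
  exact Finset.sum_le_sum fun u _ => h u

/-- From `m ≤ Q ^ m ≤ N ^ (1/8)`, the numerator `m² Q ^ (2m)` is at most `N ^ (1/2)`, while there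
are at least `N` oriented edges. -/
theorem measureReal_not_isBalanced_le_rpow [Nonempty G.Dart] {ι : G →g H}
    (hι : Function.Injective ι) (T : NonBacktrackingFlow G) (hdeg : ∀ u, 0 < G.degree u)
    (hj : 0 < j) {m : ℕ} (hm0 : 0 < m) (hm : m < G.girth)
    (hmN : m * Real.log (Fintype.card (Word k j)) ≤ 1 / 8 * Real.log (Fintype.card W)) :
    (labelMeasure H k j).real {α | ¬ IsBalanced o α ι T m} ≤
      16 * (Fintype.card W : ℝ) ^ (-(1 / 2) : ℝ) := by
  have hW : Nonempty W := ⟨(Classical.arbitrary G.Dart).fst⟩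
  have hN : (0 : ℝ) < Fintype.card W := by exact_mod_cast Fintype.card_pos
  have hND : (Fintype.card W : ℝ) ≤ Fintype.card G.Dart := by exact_mod_cast card_le_card_dart hdeg
  refine (measureReal_not_isBalanced_le o hι T hm0 hm).trans ?_
  set Q : ℝ := (Fintype.card (Word k j) : ℝ) with hQ
  have hQ2 : 2 ≤ Q := by
    have : 2 ≤ Fintype.card (Word k j) := by
      have hk := NeZero.pos k
      simp only [Fintype.card_fun, Fintype.card_prod, Fintype.card_fin, Fintype.card_bool]
      calc 2 ≤ k * 2 := by omega
        _ ≤ (k * 2) ^ j := Nat.le_self_pow hj.ne' _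
    rw [hQ]
    exact_mod_cast this
  have hQ0 : 0 < Q := by linarith
  have hmQ : (m : ℝ) ≤ Q ^ m := by
    calc (m : ℝ) ≤ 2 ^ m := by exact_mod_cast (Nat.lt_two_pow_self).le
      _ ≤ Q ^ m := by gcongr
  have hQN : Q ^ m ≤ (Fintype.card W : ℝ) ^ (1 / 8 : ℝ) := by
    rw [← Real.log_le_log_iff (by positivity) (by positivity), Real.log_pow, Real.log_rpow hN]
    exact hmN
  have hQN4 : (Q ^ m) ^ 4 ≤ (Fintype.card W : ℝ) ^ (1 / 2 : ℝ) := by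
    calc (Q ^ m) ^ 4 ≤ ((Fintype.card W : ℝ) ^ (1 / 8 : ℝ)) ^ 4 := by gcongr
      _ = _ := by rw [← Real.rpow_natCast, ← Real.rpow_mul hN.le]; norm_num
  calc 16 * m ^ 2 * Q ^ (2 * m) / Fintype.card G.Dart
      ≤ 16 * (Q ^ m) ^ 2 * Q ^ (2 * m) / Fintype.card W := by gcongr
    _ = 16 * ((Q ^ m) ^ 4 / Fintype.card W) := by ring
    _ ≤ 16 * ((Fintype.card W : ℝ) ^ (1 / 2 : ℝ) / Fintype.card W) := by gcongr
    _ = _ := by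
      congr 1
      rw [← Real.rpow_sub_one hN.ne']
      norm_num

end

/-- The inclusion of a member of a family of graphs into the disjoint union. -/
def homDisjointUnion {I : Type*} {V : I → Type*} (G : ∀ i, SimpleGraph (V i)) (i : I) :
    G i →g disjointUnion G where
  toFun := Sigma.mk i
  map_rel' h := by
    rw [disjointUnion, SimpleGraph.iSup_adj]
    exact ⟨i, (SimpleGraph.map_adj_apply (f := Function.Embedding.sigmaMk i)).2 h⟩

end RandomGroup

end

theorem mainTheorem4 :
    -- `K p` depends on the exponent only
    ∃ K : ℝ → ℝ≥0,
    ∀ (d k j : ℕ) [NeZero k] (c : ℝ), 0 < j → Even j → 0 < c →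
    -- the constants `a`, `b` in `m ≍ log N_i` depend on `d`, `k`, `j`, `c` only
    ∃ a b : ℝ, 0 < a ∧ 0 < b ∧
    ∀ (V : ℕ → Type*) [∀ i, Fintype (V i)] (G : ∀ i, SimpleGraph (V i))
      [∀ i, DecidableRel (G i).Adj] (σ : ℝ),
      (∀ i, (G i).Connected) →
      (∀ i, ¬ (G i).IsBipartite) →
      (∀ i v, 3 ≤ (G i).degree v ∧ (G i).degree v ≤ d) →
      0 < σ →
      (∀ i, (σ : EReal) ≤ RandomGroup.spectralGap (RandomGroup.graphWalk (G i))) →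
      (∀ i, c * Real.log (Fintype.card (V i)) ≤ ((G i).girth : ℝ)) →
      (∀ M : ℕ, ∃ i, M ≤ Fintype.card (V i)) →
    ∀ o : RandomGroup.Orientation (RandomGroup.disjointUnion G),
    ∀ᵐ α ∂(RandomGroup.labelMeasure (RandomGroup.disjointUnion G) k j),
    ∀ (Y : Type*) [MetricSpace Y] [MulAction (RandomGroup.RGroup o α) Y]
      [IsIsometricSMul (RandomGroup.RGroup o α) Y] (p : ℝ), 2 ≤ p →
    ∀ M : ℕ, ∃ i, M ≤ Fintype.card (V i) ∧
    ∀ f : RandomGroup.RGroup o α → Y, (∀ g x, f (g * x) = g • f x) →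
    ∃ m : ℕ,
      a * Real.log (Fintype.card (V i)) ≤ m ∧ m ≤ b * Real.log (Fintype.card (V i)) ∧
      RandomGroup.energy p (RandomGroup.walkPow (RandomGroup.treeWalk k) (j * m))
          (fun x : FreeGroup (Fin k) => f (QuotientGroup.mk x))
        ≤ K p * RandomGroup.localPoincareModulus p σ Y (Fintype.card (V i)) ^ p *
          RandomGroup.energy p (RandomGroup.walkPow (RandomGroup.treeWalk k) j)
            (fun x : FreeGroup (Fin k) => f (QuotientGroup.mk x)) := by
  open RandomGroup in
  refine ⟨fun p => 2 ^ (p + 2), fun d k j _ c hj _ hc => ?_⟩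
  set q : ℝ := Real.log (Fintype.card (Word k j)) with hq
  have hq0 : 0 < q := by
    refine Real.log_pos ?_
    have : 1 < Fintype.card (Word k j) := by
      have hk := NeZero.pos k
      simp only [Fintype.card_fun, Fintype.card_prod, Fintype.card_fin, Fintype.card_bool]
      exact Nat.one_lt_pow hj.ne' (by omega)
    exact_mod_cast this
  -- The bound `c / 2` keeps `m` below the girth; `1 / (8 * q)` gives `Q ^ m ≤ N ^ (1/8)`.
  set b : ℝ := min (c / 2) (1 / (8 * q)) with hb
  have hb0 : 0 < b := lt_min (by positivity) (by positivity)
  have hbc : b ≤ c / 2 := min_le_left _ _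
  have hbq : b * q ≤ 1 / 8 := by
    calc b * q ≤ 1 / (8 * q) * q := by gcongr; exact min_le_right _ _
      _ = 1 / 8 := by field_simp
  -- `m` will be the integer part of `b log N`; once this number is at least `1`, rounding down
  -- loses at most half.
  refine ⟨b / 2, b, by positivity, hb0, ?_⟩
  intro V _ G _ σ hG _ hdeg _ hgap hgirth hunb o
  have hdeg0 : ∀ i u, 0 < (G i).degree u := fun i u => lt_of_lt_of_le (by norm_num) (hdeg i u).1
  have hT : ∀ i, Nonempty (NonBacktrackingFlow (G i)) := fun i =>
    nonempty_nonBacktrackingFlow (G i) fun v => le_trans (by norm_num) (hdeg i v).1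
  let T : ∀ i, NonBacktrackingFlow (G i) := fun i => (hT i).some
  have hdart : ∀ i, Nonempty (G i).Dart := by
    intro i
    obtain ⟨u⟩ := (hG i).nonempty
    obtain ⟨v, hv⟩ := ((G i).degree_pos_iff_exists_adj u).1 (hdeg0 i u)
    exact ⟨⟨(u, v), hv⟩⟩
  let m : ℕ → ℕ := fun i => ⌊b * Real.log (Fintype.card (V i))⌋₊
  obtain ⟨M₀, hM₀⟩ := exists_nat_ge (Real.exp (1 / b))
  have hlog : ∀ i, M₀ ≤ Fintype.card (V i) → 1 ≤ b * Real.log (Fintype.card (V i)) := by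
    intro i hi
    have h1 : Real.exp (1 / b) ≤ Fintype.card (V i) := hM₀.trans (by exact_mod_cast hi)
    have h2 := (Real.le_log_iff_exp_le (lt_of_lt_of_le (Real.exp_pos _) h1)).2 h1
    rwa [div_le_iff₀' hb0] at h2
  have hm0 : ∀ i, M₀ ≤ Fintype.card (V i) → 0 < m i := fun i hi =>
    Nat.floor_pos.2 (hlog i hi)
  have hmle : ∀ i, M₀ ≤ Fintype.card (V i) → (m i : ℝ) ≤ b * Real.log (Fintype.card (V i)) :=
    fun i hi => Nat.floor_le (by linarith [hlog i hi])
  have hmge : ∀ i, M₀ ≤ Fintype.card (V i) →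
      b / 2 * Real.log (Fintype.card (V i)) ≤ m i := by
    intro i hi
    have h1 := Nat.lt_floor_add_one (b * Real.log (Fintype.card (V i)))
    have h2 : (1 : ℝ) ≤ m i := by exact_mod_cast hm0 i hi
    change _ < (m i : ℝ) + 1 at h1
    linarith
  have hbal : ∀ᵐ α ∂(labelMeasure (disjointUnion G) k j), ∀ M : ℕ, ∃ i,
      max M M₀ ≤ Fintype.card (V i) ∧ IsBalanced o α (homDisjointUnion G i) (T i) (m i) := by
    rw [ae_all_iff]
    intro M
    rw [ae_iff, ← measureReal_eq_zero_iff]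
    -- The event that no large index is balanced lies in the failure event of each single large
    -- index, whose probability is arbitrarily small. Neither summability nor independence between
    -- indices is needed.
    refine le_antisymm (le_of_forall_pos_le_add fun ε hε => ?_) measureReal_nonneg
    have hlim : Filter.Tendsto (fun n : ℕ => 16 * (n : ℝ) ^ (-(1 / 2) : ℝ)) Filter.atTop
        (nhds (16 * 0)) :=
      ((tendsto_rpow_neg_atTop (by norm_num : (0 : ℝ) < 1 / 2)).comp
        tendsto_natCast_atTop_atTop).const_mul 16
    rw [mul_zero] at hlim
    obtain ⟨M₁, hM₁⟩ := Filter.eventually_atTop.1 (hlim.eventually (ge_mem_nhds hε))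
    obtain ⟨i, hi⟩ := hunb (max (max M M₀) M₁)
    have hiM : max M M₀ ≤ Fintype.card (V i) := (le_max_left _ _).trans hi
    have hi0 : M₀ ≤ Fintype.card (V i) := (le_max_right _ _).trans hiM
    have hlogpos : 0 < Real.log (Fintype.card (V i)) := by
      have := hlog i hi0
      exact pos_of_mul_pos_right (by linarith) hb0.le
    have hsub : {α : (disjointUnion G).edgeSet → Word k j | ¬ ∃ i, max M M₀ ≤ Fintype.card (V i) ∧
        IsBalanced o α (homDisjointUnion G i) (T i) (m i)} ⊆
        {α | ¬ IsBalanced o α (homDisjointUnion G i) (T i) (m i)} :=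
      fun α hα h => hα ⟨i, hiM, h⟩
    have := hdart i
    have hgi : m i < (G i).girth := by
      have h1 : (m i : ℝ) < (G i).girth := by
        calc (m i : ℝ) ≤ b * Real.log (Fintype.card (V i)) := hmle i hi0
          _ ≤ c / 2 * Real.log (Fintype.card (V i)) := by gcongr
          _ < c * Real.log (Fintype.card (V i)) := by nlinarith
          _ ≤ _ := hgirth i
      exact_mod_cast h1
    have hbd := measureReal_not_isBalanced_le_rpow o (ι := homDisjointUnion G i)
      sigma_mk_injective (T i) (hdeg0 i) hj (hm0 i hi0) hgi (by
        rw [← hq]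
        calc (m i : ℝ) * q ≤ b * Real.log (Fintype.card (V i)) * q := by
              gcongr
              exact hmle i hi0
          _ = b * q * Real.log (Fintype.card (V i)) := by ring
          _ ≤ _ := by gcongr)
    rw [zero_add]
    exact (measureReal_mono hsub).trans (hbd.trans (hM₁ _ ((le_max_right _ _).trans hi)))
  filter_upwards [hbal] with α hα
  -- Balance involves only the labeling and the index, so one null set serves all spaces, actions
  -- and exponents, and `i` and `m` serve every `f`.
  intro Y _ _ _ p hp M
  obtain ⟨i, hi, hαi⟩ := hα M
  have hi0 : M₀ ≤ Fintype.card (V i) := (le_max_right _ _).trans hi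
  have := hdart i
  refine ⟨i, (le_max_left _ _).trans hi, fun f hf => ⟨m i, hmge i hi0, hmle i hi0, ?_⟩⟩
  have key := energy_le_of_isBalanced o α (by linarith : 1 ≤ p) (hG i) (hdeg0 i) (hgap i)
    (homDisjointUnion G i) (T i) hαi hf
  refine key.trans_eq ?_
  rw [ENNReal.coe_rpow_of_nonneg _ (by linarith)]
  rfl
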